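/- All structures are sets with one binary relation: a poset is taken with its order $\le$, a (simple, undirected, loopless) graph with its adjacency relation. A class of finite structures is *hereditary* if it contains every structure that embeds (as an induced substructure) into one of its members. The *age* $\mathrm{age}(R)$ of a structure $R$ is the class of all finite structures that embed into $R$. A *module* of a structure $R=(V,\rho)$ is a subset $A\subseteq V$ such that, for all $a,a'\in A$ and $v\in V\setminus A$, $(v,a)\in\rho\Rightarrow(v,a')\in\rho$ and $(a,v)\in\rho\Rightarrow(a',v)\in\rho$. The structure $R$ is *prime* if its only modules are $\emptyset$, the singletons and $V$. A hereditary class $\mathcal C$ of finite structures is *minimal prime* if it contains infinitely many prime structures up to isomorphism, while every hereditary class properly contained in $\mathcal C$ contains only finitely many prime structures up to isomorphism. The *incomparability graph* $\mathrm{Inc}(P)$ of a poset $P$ has the elements of $P$ as vertices and the pairs of incomparable elements as edges. A poset has width at most two if each of its antichains has at most two elements. Let $P_1$ be the poset on $\mathbb N$ whose order is the intersection of the natural order with the linear order that puts the odd integers (in natural order) before the even integers (in natural order). Let $P_2$ be the poset on $\mathbb N$ in which $x<y$ if and only if $x+2\le y$ in the natural order. Let $H$ be the half-complete bipartite graph,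 with vertices $a_i,b_i$ ($i\in\mathbb N$) and edges $\{a_i,b_j\}$ for $i\le j$, and let $\mathrm P_\infty$ be the one-way infinite path, with vertex set $\mathbb N$ and edges $\{i,i+1\}$. **Theorem.** The posets $P_1$ and $P_2$ have width at most two, $\mathrm{Inc}(P_1)\cong H$ and $\mathrm{Inc}(P_2)\cong \mathrm P_\infty$. Moreover: 1. If $\mathcal C$ is a hereditary class of finite posets of width at most two, then $\mathcal C$ is minimal prime if and only if $\mathcal C=\mathrm{age}(P_1)$ or $\mathcal C=\mathrm{age}(P_2)$. 2. If $\mathcal C$ is a hereditary class of finite graphs each of which is the incomparability graph of a poset of width at most two, then $\mathcal C$ is minimal prime if and only if $\mathcal C=\mathrm{age}(H)$ or $\mathcal C=\mathrm{age}(\mathrm P_\infty)$. -/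

import Mathlib

universe u

namespace MinimalPrime

/-- A finite relational structure with one binary relation. A finite poset is such a structure
(with its order relation `≤`), and so is a finite graph (with its adjacency relation). -/
structure FinStr : Type (u + 1) where
  carrier : Type u
  finite : Finite carrier
  rel : carrier → carrier → Prop

/-- `R` is embeddable in `S`: it is isomorphic to an induced substructure of `S`. -/
def FinStr.Embeds (R S : FinStr.{u}) : Prop :=
  Nonempty (R.rel ↪r S.rel)

/-- Isomorphy of finite structures. -/
def isoSetoid : Setoid FinStr.{u} where
  r R S := Nonempty (R.rel ≃r S.rel)
  iseqv :=
    { refl := fun R => ⟨RelIso.refl R.rel⟩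
      symm := fun ⟨e⟩ => ⟨e.symm⟩
      trans := fun ⟨e⟩ ⟨f⟩ => ⟨e.trans f⟩ }

/-- A class of finite structures is hereditary if it contains every structure that embeds into
one of its members. In particular it is closed under isomorphy. -/
def IsHereditary (C : Set FinStr.{u}) : Prop :=
  ∀ R S : FinStr.{u}, S ∈ C → R.Embeds S → R ∈ C

/-- The age of a (possibly infinite) structure `(α, r)`: all finite structures embedding in it. -/
def age {α : Type*} (r : α → α → Prop) : Set FinStr.{u} :=
  {R | Nonempty (R.rel ↪r r)}

/-- `A` is a module (or interval) of the structure `(α, r)`. -/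
def IsModule {α : Type*} (r : α → α → Prop) (A : Set α) : Prop :=
  ∀ a ∈ A, ∀ a' ∈ A, ∀ v ∉ A, (r v a → r v a') ∧ (r a v → r a' v)

/-- `(α, r)` is prime (or indecomposable): its only modules are the empty set, the singletons and
the whole set. -/
def IsPrime {α : Type*} (r : α → α → Prop) : Prop :=
  ∀ A : Set α, IsModule r A → A = ∅ ∨ (∃ a, A = {a}) ∨ A = Set.univ

/-- The isomorphism types of the prime members of a class. -/
def primeTypes (C : Set FinStr.{u}) : Set (Quotient isoSetoid.{u}) :=
  Quotient.mk isoSetoid '' {R | R ∈ C ∧ IsPrime R.rel}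

/-- A minimal prime class: a hereditary class which contains infinitely many prime structures (up
to isomorphy), while every proper hereditary subclass contains only finitely many. -/
structure IsMinimalPrime (C : Set FinStr.{u}) : Prop where
  hereditary : IsHereditary C
  infinite : (primeTypes C).Infinite
  minimal : ∀ D : Set FinStr.{u}, D ⊂ C → IsHereditary D → (primeTypes D).Finite

/-- Every antichain of `(α, r)` has at most two elements. -/
def WidthLeTwo {α : Type*} (r : α → α → Prop) : Prop :=
  ∀ s : Set α, IsAntichain r s → s.encard ≤ 2

/-- `R` is a poset of width at most two. -/
def FinStr.IsPosetWidthLeTwo (R : FinStr.{u}) : Prop :=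
  IsPartialOrder R.carrier R.rel ∧ WidthLeTwo R.rel

/-- `R` is the incomparability graph of some poset of width at most two (on the same set): its
edges are the pairs of incomparable elements. -/
def FinStr.IsIncGraphWidthLeTwo (R : FinStr.{u}) : Prop :=
  ∃ le : R.carrier → R.carrier → Prop, IsPartialOrder R.carrier le ∧ WidthLeTwo le ∧
    ∀ x y, R.rel x y ↔ IncompRel le x y

/-- The order relation on `ℕ` of the poset `P₁`: the intersection of the natural order of `ℕ` with
the linear order that puts the odd integers, in their natural order, before the even integers, in
their natural order. -/
def P₁ (x y : ℕ) : Prop :=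
  x ≤ y ∧ ((x % 2 = y % 2 ∧ x ≤ y) ∨ (x % 2 = 1 ∧ y % 2 = 0))

instance isPartialOrder_P₁ : IsPartialOrder ℕ P₁ where
  refl x := ⟨le_rfl, Or.inl ⟨rfl, le_rfl⟩⟩
  trans x y z h₁ h₂ := by unfold P₁ at *; omega
  antisymm x y h₁ h₂ := le_antisymm h₁.1 h₂.1

/-- The order relation on `ℕ` of the poset `P₂`, where `x < y` if and only if `x + 2 ≤ y`. -/
def P₂ (x y : ℕ) : Prop :=
  x = y ∨ x + 2 ≤ y

instance isPartialOrder_P₂ : IsPartialOrder ℕ P₂ where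
  refl x := Or.inl rfl
  trans x y z h₁ h₂ := by unfold P₂ at *; omega
  antisymm x y h₁ h₂ := by unfold P₂ at *; omega

/-- The half-complete bipartite graph `H`, with `aᵢ = inl i`, `bⱼ = inr j` and the edges
`{aᵢ, bⱼ}` for `i ≤ j`. -/
def halfGraph : SimpleGraph (ℕ ⊕ ℕ) where
  Adj x y := ∃ i j : ℕ, i ≤ j ∧
    ((x = Sum.inl i ∧ y = Sum.inr j) ∨ (x = Sum.inr j ∧ y = Sum.inl i))
  symm := ⟨fun _ _ ⟨i, j, h, h'⟩ => ⟨i, j, h, h'.elim (fun e => Or.inr ⟨e.2, e.1⟩)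
    (fun e => Or.inl ⟨e.2, e.1⟩)⟩⟩
  loopless := ⟨fun x ⟨i, j, _, h'⟩ => by
    rcases h' with ⟨h₁, h₂⟩ | ⟨h₁, h₂⟩ <;> simp [h₁] at h₂⟩

/-- The one way infinite path: the vertices are the natural numbers, and `{i, j}` is an edge if
and only if `i` and `j` are consecutive. -/
def infinitePath : SimpleGraph ℕ where
  Adj i j := i + 1 = j ∨ j + 1 = i
  symm := ⟨fun _ _ h => h.symm⟩
  loopless := ⟨fun _ h => by omega⟩

end MinimalPrime

/-! The components of the incomparability graph of a poset are modules, so a prime poset with at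
least three elements has a connected one. A large connected graph has long induced paths or a vertex
of large degree. An induced path forces the order up to duality and yields a piece of `P₂`
(`restr_P₂_embeds`). The neighbours of a vertex `v` form a chain by the width bound; primality
separates consecutive ones by elements comparable to `v`, and half of these lie on the same side of
`v`, which yields a piece of `P₁` (`restr_P₁_embeds`). Hence a hereditary class with infinitely many
primes contains one of the two ages. Both ages have infinitely many primes and neither contains the
other, so they are exactly the minimal classes (`isMinimalPrime_iff`). The graph case follows
because a poset with prime incomparability graph is prime and embeddings of posets embed their
incomparability graphs. -/

namespace SimpleGraph

/-! ### Distance, induced paths and balls in graphs. -/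

variable {V : Type*} {G : SimpleGraph V}

/-- A vertex at distance `m + 1` from `v` has a neighbour at distance `m` from `v`. -/
theorem exists_adj_dist_eq_of_dist_eq_succ {v u : V} {m : ℕ} (h : G.dist v u = m + 1) :
    ∃ w, G.Adj w u ∧ G.dist v w = m := by
  obtain ⟨p, hp⟩ := G.exists_walk_of_dist_ne_zero (u := u) (v := v) (by rw [dist_comm]; omega)
  cases p with
  | nil => simp at h
  | @cons _ w _ hadj q =>
    refine ⟨w, hadj.symm, ?_⟩
    have h1 := G.dist_le q
    rw [Walk.length_cons, dist_comm, h] at hp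
    have h2 := (Walk.cons hadj q).reachable.dist_triangle_left v
    have h3 : G.Reachable u w := hadj.reachable
    have h4 := h3.dist_triangle_left v
    rw [dist_comm, h, dist_eq_one_iff_adj.2 hadj, dist_comm (u := w)] at h4
    rw [dist_comm] at h1
    omega

/-- A geodesic of length `m`, as a sequence of vertices. -/
theorem exists_geodesic {v : V} (m : ℕ) (u : V) (h : G.dist v u = m) :
    ∃ p : ℕ → V, (∀ i ≤ m, G.dist v (p i) = i) ∧ (∀ i < m, G.Adj (p i) (p (i + 1))) ∧ p m = u := by
  induction m generalizing u with
  | zero => exact ⟨fun _ => u, by simpa using h, by simp, rfl⟩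
  | succ m ih =>
    obtain ⟨w, hw, hd⟩ := exists_adj_dist_eq_of_dist_eq_succ h
    obtain ⟨p, h1, h2, h3⟩ := ih w hd
    refine ⟨fun i => if i ≤ m then p i else u, fun i hi => ?_, fun i hi => ?_, by simp⟩
    · by_cases him : i ≤ m
      · simp [him, h1]
      · obtain rfl : i = m + 1 := by omega
        simpa using h
    · by_cases him : i + 1 ≤ m
      · simp [him, h2 i (by omega), (by omega : i ≤ m)]
      · obtain rfl : i = m := by omega
        simpa [h3] using hw

/-- If there is a vertex at distance at least `m` from `v`, then `G` has an induced path of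
length `m`. -/
theorem exists_induced_path (hG : G.Connected) {v u : V} {m : ℕ} (h : m ≤ G.dist v u) :
    ∃ p : ℕ → V, ∀ i ≤ m, ∀ j ≤ m, (p i = p j → i = j) ∧
      (G.Adj (p i) (p j) ↔ i + 1 = j ∨ j + 1 = i) := by
  obtain ⟨p, h1, h2, -⟩ := exists_geodesic (G.dist v u) u rfl
  refine ⟨p, fun i hi j hj => ⟨fun e => ?_, fun e => ?_, ?_⟩⟩
  · rw [← h1 i (by omega), ← h1 j (by omega), e]
  -- Adjacent vertices lie at distances from `v` differing by at most one, so a geodesic has no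
  -- chords.
  · have h3 := h1 i (by omega)
    have h4 := h1 j (by omega)
    have h5 := hG.dist_triangle (u := v) (v := p i) (w := p j)
    have h6 := hG.dist_triangle (u := v) (v := p j) (w := p i)
    rw [dist_eq_one_iff_adj.2 e] at h5
    rw [dist_eq_one_iff_adj.2 e.symm] at h6
    have h7 : i ≠ j := by rintro rfl; exact G.loopless.irrefl _ e
    omega
  · rintro (rfl | rfl)
    · exact h2 i (by omega)
    · exact (h2 j (by omega)).symm

/-- Balls of radius `m` in a graph of maximum degree at most `d`. -/
theorem ncard_dist_le [Finite V] (hG : G.Connected) {d : ℕ}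
    (hd : ∀ x, (G.neighborSet x).ncard ≤ d) (v : V) (m : ℕ) :
    {u | G.dist v u ≤ m}.ncard ≤ (d + 1) ^ m := by
  classical
  have := Fintype.ofFinite V
  induction m with
  | zero =>
    have : {u | G.dist v u ≤ 0} = {v} := by
      ext u; simp [-SimpleGraph.dist_eq_zero_iff_eq_or_not_reachable, hG.dist_eq_zero_iff, eq_comm]
    rw [this, Set.ncard_singleton, pow_zero]
  | succ m ih =>
    -- The larger ball is covered by the closed neighbourhoods of the smaller one, each of size at
    -- most `d + 1`.
    have hsub : {u | G.dist v u ≤ m + 1} ⊆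
        ↑(({u | G.dist v u ≤ m}.toFinset).biUnion fun x => insert x (G.neighborFinset x)) := by
      intro u hu
      simp only [Set.mem_ofPred_eq] at hu
      simp only [Finset.coe_biUnion, Set.mem_iUnion, Set.mem_toFinset, Finset.mem_coe,
        Finset.mem_insert, mem_neighborFinset, Set.mem_ofPred_eq]
      rcases hu.lt_or_eq with h | h
      · exact ⟨u, by omega, Or.inl rfl⟩
      · obtain ⟨w, hw, hdw⟩ := exists_adj_dist_eq_of_dist_eq_succ h
        exact ⟨w, hdw.le, Or.inr hw⟩
    refine (Set.ncard_le_ncard hsub (Set.toFinite _)).trans ?_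
    rw [Set.ncard_coe_finset, pow_succ]
    refine (Finset.card_biUnion_le_card_mul _ _ (d + 1) fun x _ => ?_).trans ?_
    · refine (Finset.card_insert_le _ _).trans ?_
      have := hd x
      rw [Set.ncard_eq_toFinset_card', Set.toFinset_card, card_neighborSet_eq_degree] at this
      rw [card_neighborFinset_eq_degree]
      omega
    · rw [← Set.ncard_eq_toFinset_card']
      exact Nat.mul_le_mul_right _ ih

/-- A large finite connected graph has a vertex of large degree or two vertices at large
distance. -/
theorem exists_lt_ncard_neighborSet_or_lt_dist [Finite V] (hG : G.Connected) {d m : ℕ}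
    (h : (d + 1) ^ m < Nat.card V) :
    (∃ x, d < (G.neighborSet x).ncard) ∨ ∃ v u, m < G.dist v u := by
  by_contra! hc
  obtain ⟨v⟩ := hG.nonempty
  have h1 := ncard_dist_le hG hc.1 v m
  rw [show {u | G.dist v u ≤ m} = Set.univ from Set.eq_univ_of_forall (hc.2 v),
    Set.ncard_univ] at h1
  omega

end SimpleGraph

/-! ### Width two and initial segments. -/

namespace MinimalPrime

theorem widthLeTwo_iff {α : Type*} {r : α → α → Prop} [Std.Refl r] :
    WidthLeTwo r ↔ ∀ a b c, IncompRel r a b → IncompRel r b c → IncompRel r a c → False := by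
  constructor
  · intro h a b c hab hbc hac
    have h1 : IsAntichain r {a, b, c} := by
      have := hab.symm
      have := hbc.symm
      have := hac.symm
      rintro x hx y hy hne hr
      simp only [Set.mem_insert_iff, Set.mem_singleton_iff] at hx hy
      unfold IncompRel at *
      grind
    have h2 := h _ h1
    rw [Set.encard_insert_of_notMem (by simp [hab.ne, hac.ne]), Set.encard_pair hbc.ne] at h2
    exact absurd h2 (by decide)
  · intro h s hs
    by_contra! hc
    obtain ⟨t, hts, ht⟩ := Set.exists_subset_encard_eq (k := 3) (s := s) (Order.add_one_le_of_lt hc)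
    obtain ⟨a, b, c, hab, hac, hbc, rfl⟩ := Set.encard_eq_three.1 ht
    have ha : a ∈ s := hts (by simp)
    have hb : b ∈ s := hts (by simp)
    have hc : c ∈ s := hts (by simp)
    exact h a b c ⟨hs ha hb hab, hs hb ha hab.symm⟩ ⟨hs hb hc hbc, hs hc hb hbc.symm⟩
      ⟨hs ha hc hac, hs hc ha hac.symm⟩

/-- The restriction to `{0, …, n - 1}` of a binary relation on `ℕ`. -/
def restr (s : ℕ → ℕ → Prop) (n : ℕ) : FinStr.{u} where
  carrier := ULift.{u} (Fin n)
  finite := inferInstance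
  rel x y := s x.down y.down

/-- Injectivity is free: equal images are related both ways by reflexivity of `r`, and `s` is
antisymmetric. -/
theorem restr_embeds_of {α : Type*} {s : ℕ → ℕ → Prop} [IsPartialOrder ℕ s] {r : α → α → Prop}
    [Std.Refl r] (n : ℕ)
    (f : ℕ → α) (hf : ∀ i < n, ∀ j < n, (r (f i) (f j) ↔ s i j)) :
    Nonempty ((restr.{u} s n).rel ↪r r) := by
  refine ⟨⟨⟨fun x => f x.down, fun x y hxy => ?_⟩, fun {x y} => ?_⟩⟩
  · dsimp only at hxy
    have h1 := (hf x.down x.down.2 y.down y.down.2).1 (hxy ▸ Std.Refl.refl _)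
    have h2 := (hf y.down y.down.2 x.down x.down.2).1 (hxy ▸ Std.Refl.refl _)
    exact ULift.ext _ _ (Fin.ext (antisymm_of s h1 h2))
  · exact hf x.down x.down.2 y.down y.down.2

/-! ### Connectedness of the incomparability graph, and long induced paths. -/

section Poset

variable {α : Type*} [PartialOrder α]

/-- The incomparability graph of a partial order. -/
def incGraph (α : Type*) [PartialOrder α] : SimpleGraph α where
  Adj := IncompRel (· ≤ ·)
  symm := ⟨fun _ _ h => h.symm⟩
  loopless := ⟨fun _ h => h.1 le_rfl⟩

/-- An element comparable to both ends of an edge of the incomparability graph has the same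
relation to both. -/
theorem le_of_incompRel {a b v : α} (hab : IncompRel (· ≤ ·) a b) (hb : ¬ IncompRel (· ≤ ·) v b) :
    (v ≤ a → v ≤ b) ∧ (a ≤ v → b ≤ v) := by
  constructor
  · intro h
    by_contra hn
    exact hb ⟨hn, fun h' => hab.2 (h'.trans h)⟩
  · intro h
    by_contra hn
    exact hb ⟨fun h' => hab.1 (h.trans h'), hn⟩

/-- An element outside a component is comparable to all of it, so its relation is constant along
every walk inside. -/
theorem isModule_setOf_reachable (a : α) :
    IsModule (· ≤ ·) {b : α | (incGraph α).Reachable a b} := by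
  intro b hb c hc v hv
  have hbc : (incGraph α).Reachable b c := hb.symm.trans hc
  obtain ⟨p⟩ := hbc
  clear hc
  induction p with
  | nil => exact ⟨id, id⟩
  | @cons x y z hxy p ih =>
    have hy : (incGraph α).Reachable a y := hb.trans hxy.reachable
    have h1 := le_of_incompRel (v := v) hxy
      fun h => hv (hy.trans (SimpleGraph.Adj.reachable (G := incGraph α) h.symm))
    exact ⟨(ih hy).1 ∘ h1.1, (ih hy).2 ∘ h1.2⟩

/-- A finite chain with at least three elements is not prime. -/
theorem not_isPrime_of_chain [Finite α] (h3 : 2 < Nat.card α) (h : ∀ a b : α, a ≤ b ∨ b ≤ a) :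
    ¬ IsPrime (fun a b : α => a ≤ b) := by
  intro hp
  have : Nonempty α := (Nat.card_pos_iff.1 (by omega)).1
  obtain ⟨a, ha⟩ := 
    (Set.toFinite (Set.univ : Set α)).exists_minimal ⟨Classical.arbitrary α, trivial⟩
  have ha' : ∀ x, a ≤ x := fun x => (h a x).elim id fun h' => ha.2 trivial h'
  -- Removing the least element leaves a module, which is nontrivial by cardinality.
  have hm : IsModule (fun a b : α => a ≤ b) {x | x ≠ a} := by
    intro b hb c hc v hv
    obtain rfl : v = a := by simpa using hv
    exact ⟨fun _ => ha' c, fun h' => absurd (le_antisymm h' (ha' b)) hb⟩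
  have hcard : ({x | x ≠ a} : Set α).ncard = Nat.card α - 1 := by
    rw [show ({x | x ≠ a} : Set α) = {a}ᶜ from rfl, Set.ncard_compl, Set.ncard_singleton]
  rcases hp _ hm with h | ⟨b, h⟩ | h
  · rw [h, Set.ncard_empty] at hcard; omega
  · rw [h, Set.ncard_singleton] at hcard; omega
  · exact (Set.eq_univ_iff_forall.1 h a) rfl

theorem connected_incGraph [Finite α] (h3 : 2 < Nat.card α)
    (hp : IsPrime (fun a b : α => a ≤ b)) : (incGraph α).Connected := by
  obtain ⟨a, b, hab⟩ : ∃ a b : α, IncompRel (· ≤ ·) a b := by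
    by_contra! hc
    refine not_isPrime_of_chain h3 (fun a b => ?_) hp
    by_contra! hab
    exact hc a b hab
  have hb : (incGraph α).Reachable a b := SimpleGraph.Adj.reachable (G := incGraph α) hab
  rcases hp _ (isModule_setOf_reachable a) with h | ⟨c, h⟩ | h
  · exact absurd h (Set.nonempty_iff_ne_empty.1 ⟨a, SimpleGraph.Reachable.refl a⟩)
  · have h1 : a ∈ ({c} : Set α) := h ▸ SimpleGraph.Reachable.refl a
    have h2 : b ∈ ({c} : Set α) := h ▸ hb
    exact absurd (h1.trans h2.symm) hab.ne
  · have : Nonempty α := ⟨a⟩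
    refine ⟨fun x y => ?_⟩
    rw [Set.eq_univ_iff_forall] at h
    exact (h x).symm.trans (h y)

/-- Comparabilities slide along edges: moving the upper end gives `p i ≤ p (i + 3)` from `p i ≤ p (i
+ 2)`, and moving the lower end then gives `p (i + 1) ≤ p (i + 3)`. -/
theorem lt_path {p : ℕ → α} {m : ℕ}
    (hp : ∀ i ≤ m, ∀ j ≤ m, (IncompRel (· ≤ ·) (p i) (p j) ↔ i + 1 = j ∨ j + 1 = i))
    (h2 : p 0 ≤ p 2) (i : ℕ) : ∀ j ≤ m, i + 2 ≤ j → p i ≤ p j := by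
  have step : ∀ i, (i + 2 ≤ m → p i ≤ p (i + 2)) → ∀ j ≤ m, i + 2 ≤ j → p i ≤ p j := by
    intro i h j hj hij
    induction j, hij using Nat.le_induction with
    | base => exact h hj
    | succ j hij ih =>
      exact (le_of_incompRel ((hp j (by omega) (j + 1) hj).2 (by omega))
        (fun h => by have := (hp i (by omega) (j + 1) hj).1 h; omega)).1 (ih (by omega))
  induction i with
  | zero => exact step 0 fun _ => h2
  | succ i ih =>
    refine step (i + 1) fun h => ?_
    exact (le_of_incompRel ((hp i (by omega) (i + 1) (by omega)).2 (by omega))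
      (fun h' => by
        have := (hp (i + 1 + 2) (by omega) (i + 1) (by omega)).1 h'; omega)).2
      (ih (i + 1 + 2) h (by omega))

theorem restr_P₂_embeds_of_le {p : ℕ → α} {m : ℕ}
    (hp : ∀ i ≤ m, ∀ j ≤ m, (IncompRel (· ≤ ·) (p i) (p j) ↔ i + 1 = j ∨ j + 1 = i))
    (hinj : ∀ i ≤ m, ∀ j ≤ m, p i = p j → i = j)
    (h2 : p 0 ≤ p 2) : Nonempty ((restr.{u} P₂ m).rel ↪r ((· ≤ ·) : α → α → Prop)) := by
  refine restr_embeds_of m p fun i hi j hj => ⟨fun h => ?_, ?_⟩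
  · by_contra hn
    unfold P₂ at hn
    rcases (by omega : i + 1 = j ∨ j + 1 = i ∨ j + 2 ≤ i) with h' | h' | h'
    · exact ((hp i hi.le j hj.le).2 (Or.inl h')).1 h
    · exact ((hp i hi.le j hj.le).2 (Or.inr h')).1 h
    · have := hinj i hi.le j hj.le (le_antisymm h (lt_path hp h2 j i hi.le h'))
      omega
  · rintro (rfl | h)
    · exact le_rfl
    · exact lt_path hp h2 i j hj.le h

theorem restr_P₂_embeds {p : ℕ → α} {m : ℕ}
    (hp : ∀ i ≤ m, ∀ j ≤ m, (IncompRel (· ≤ ·) (p i) (p j) ↔ i + 1 = j ∨ j + 1 = i))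
    (hinj : ∀ i ≤ m, ∀ j ≤ m, p i = p j → i = j)
    (hm : 2 ≤ m) : Nonempty ((restr.{u} P₂ m).rel ↪r ((· ≤ ·) : α → α → Prop)) := by
  by_cases h0 : p 0 ≤ p 2
  · exact restr_P₂_embeds_of_le hp hinj h0
  have h0' : p 2 ≤ p 0 := by
    by_contra h
    have := (hp 0 (by omega) 2 hm).1 ⟨h0, h⟩
    omega
  -- If the path descends, the dual order shows that it descends throughout, and reading it
  -- backwards makes it ascend.
  have hd : ∀ i j, i ≤ m → j ≤ m → i + 2 ≤ j → p j ≤ p i := fun i j _ hj hij =>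
    lt_path (α := αᵒᵈ) (p := fun i => OrderDual.toDual (p i)) (m := m)
      (fun i hi j hj => by
        rw [← hp i hi j hj]; exact ⟨fun h => ⟨h.2, h.1⟩, fun h => ⟨h.2, h.1⟩⟩) h0' i j hj hij
  refine restr_P₂_embeds_of_le (p := fun i => p (m - i)) (m := m) (fun i hi j hj => ?_)
    (fun i hi j hj h => ?_) (hd _ _ (by omega) (by omega) (by omega))
  · rw [hp _ (by omega) _ (by omega)]; omega
  · have := hinj _ (by omega) _ (by omega) h; omega

theorem restr_P₁_embeds_of {n : ℕ} {a b : Fin n → α} (ha : StrictMono a) (hb : StrictMono b)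
    (hba : ∀ i j, b j ≤ a i ↔ j < i) (hab : ∀ i j, ¬ a i ≤ b j) :
    Nonempty ((restr.{u} P₁ n).rel ↪r ((· ≤ ·) : α → α → Prop)) := by
  rcases Nat.eq_zero_or_pos n with rfl | hn
  · exact ⟨⟨⟨fun x => x.down.elim0, fun x => x.down.elim0⟩, fun {x} => x.down.elim0⟩⟩
  -- Even numbers go to `a`, odd ones to `b`; the default value is never reached for `i < n`.
  let k : ℕ → Fin n := fun i => if h : i / 2 < n then ⟨i / 2, h⟩ else ⟨0, hn⟩
  have hk : ∀ i < n, (k i : ℕ) = i / 2 := fun i hi => by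
    simp [k, (by omega : i / 2 < n)]
  refine restr_embeds_of n (fun i => if i % 2 = 0 then a (k i) else b (k i)) fun i hi j hj => ?_
  have hki := hk i hi
  have hkj := hk j hj
  unfold P₁
  by_cases h1 : i % 2 = 0 <;> by_cases h2 : j % 2 = 0
  · rw [if_pos h1, if_pos h2, ha.le_iff_le, Fin.le_def]; omega
  · rw [if_pos h1, if_neg h2]; exact iff_of_false (hab _ _) (by omega)
  · rw [if_neg h1, if_pos h2, hba, Fin.lt_def]; omega
  · rw [if_neg h1, if_neg h2, hb.le_iff_le, Fin.le_def]; omega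

end Poset
end MinimalPrime
namespace MinimalPrime
-- Vertices of large degree.
section Poset

variable {α : Type*} [PartialOrder α]

/-- Two consecutive elements of the chain of elements incomparable to `v` are not a module. -/
theorem exists_separator (hp : IsPrime (fun a b : α => a ≤ b)) {v x y : α}
    (hx : IncompRel (· ≤ ·) x v) (hy : IncompRel (· ≤ ·) y v) (hxy : x < y)
    (hcov : ∀ z, IncompRel (· ≤ ·) z v → z ≤ x ∨ y ≤ z) :
    ∃ w, (w ≤ v ∧ w ≤ y ∧ ¬ w ≤ x) ∨ (v ≤ w ∧ x ≤ w ∧ ¬ y ≤ w) := by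
  have hm : ¬ IsModule (fun a b : α => a ≤ b) {x, y} := by
    intro hm
    rcases hp _ hm with h | ⟨c, h⟩ | h
    · exact (Set.insert_nonempty x {y}).ne_empty h
    · have h1 : x ∈ ({c} : Set α) := h ▸ Set.mem_insert x _
      have h2 : y ∈ ({c} : Set α) := h ▸ Set.mem_insert_of_mem x rfl
      exact hxy.ne (h1.trans h2.symm)
    · rcases (h ▸ Set.mem_univ v : v ∈ ({x, y} : Set α)) with rfl | rfl
      · exact hx.1 le_rfl
      · exact hy.1 le_rfl
  have key : ∃ w, w ≠ x ∧ w ≠ y ∧ ((w ≤ y ∧ ¬ w ≤ x) ∨ (x ≤ w ∧ ¬ y ≤ w)) := by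
    by_contra! hc
    refine hm fun a ha a' ha' w hw => ?_
    have hwx : w ≠ x := fun h => hw (by simp [h])
    have hwy : w ≠ y := fun h => hw (by simp [h])
    have h1 := (hc w hwx hwy).1
    have h2 := (hc w hwx hwy).2
    rcases ha with rfl | rfl <;> rcases ha' with rfl | rfl
    · exact ⟨id, id⟩
    · exact ⟨fun h => h.trans hxy.le, h2⟩
    · exact ⟨h1, fun h => hxy.le.trans h⟩
    · exact ⟨id, id⟩
  obtain ⟨w, hwx, hwy, h⟩ := key
  -- By `hcov`, no element incomparable to `v` can separate `x` from `y`.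
  have hwv : ¬ IncompRel (· ≤ ·) w v := by
    intro hw
    rcases h with ⟨h1, h2⟩ | ⟨h1, h2⟩ <;> rcases hcov w hw with h3 | h3
    · exact h2 h3
    · exact hwy (le_antisymm h1 h3)
    · exact hwx (le_antisymm h3 h1)
    · exact h2 h3
  have hwv' : w ≤ v ∨ v ≤ w := by
    by_contra! hc
    exact hwv hc
  refine ⟨w, ?_⟩
  rcases h with ⟨h1, h2⟩ | ⟨h1, h2⟩
  · exact Or.inl ⟨hwv'.resolve_right fun h3 => hy.2 (h3.trans h1), h1, h2⟩
  · exact Or.inr ⟨hwv'.resolve_left fun h3 => hx.1 (h1.trans h3), h1, h2⟩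

/-- In a poset of width at most two, the elements incomparable to `v` form a chain. -/
theorem exists_enum_incompRel [Finite α] (hw : WidthLeTwo (fun a b : α => a ≤ b)) (v : α) :
    ∃ c : ℕ → α, (∀ i < ((incGraph α).neighborSet v).ncard, IncompRel (· ≤ ·) (c i) v) ∧
      (∀ i < ((incGraph α).neighborSet v).ncard, ∀ j < ((incGraph α).neighborSet v).ncard,
        (c i ≤ c j ↔ i ≤ j)) ∧
      ∀ z, IncompRel (· ≤ ·) z v → ∃ i < ((incGraph α).neighborSet v).ncard, c i = z := by
  classical
  let S := {x : α // x ∈ (incGraph α).neighborSet v}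
  let : LinearOrder S :=
    { (inferInstance : PartialOrder S) with
      le_total := fun x y => by
        by_contra! h
        exact widthLeTwo_iff.1 hw v x.1 y.1 x.2 ⟨h.1, h.2⟩ y.2
      toDecidableLE := Classical.decRel _ }
  let := Fintype.ofFinite S
  have hcard : Fintype.card S = ((incGraph α).neighborSet v).ncard := by
    rw [← Nat.card_eq_fintype_card]; rfl
  let e := Fintype.orderIsoFinOfCardEq S hcard
  refine ⟨fun i => if h : i < _ then (e ⟨i, h⟩).1 else v, fun i hi => ?_, fun i hi j hj => ?_,
    fun z hz => ?_⟩
  · beta_reduce; rw [dif_pos hi]; exact IncompRel.symm (e ⟨i, hi⟩).2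
  · beta_reduce; rw [dif_pos hi, dif_pos hj]
    exact e.le_iff_le (x := ⟨i, hi⟩) (y := ⟨j, hj⟩)
  · refine ⟨e.symm ⟨z, hz.symm⟩, (e.symm ⟨z, hz.symm⟩).2, ?_⟩
    simp

theorem restr_P₁_embeds [Finite α] (hw : WidthLeTwo (fun a b : α => a ≤ b))
    (hp : IsPrime (fun a b : α => a ≤ b)) {v : α} {n : ℕ}
    (hv : 2 * n < ((incGraph α).neighborSet v).ncard) :
    Nonempty ((restr.{u} P₁ n).rel ↪r ((· ≤ ·) : α → α → Prop)) := by
  classical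
  obtain ⟨c, hc, hcle, hcs⟩ := exists_enum_incompRel hw v
  have h3 := widthLeTwo_iff.1 hw
  set d := ((incGraph α).neighborSet v).ncard
  have hsep : ∀ i, i + 1 < d → ∃ w, (w ≤ v ∧ w ≤ c (i + 1) ∧ ¬ w ≤ c i) ∨
      (v ≤ w ∧ c i ≤ w ∧ ¬ c (i + 1) ≤ w) := by
    intro i hi
    refine exists_separator hp (hc i (by omega)) (hc _ hi) (lt_of_le_not_ge ?_ ?_) fun z hz => ?_
    · exact (hcle _ (by omega) _ hi).2 (by omega)
    · exact fun h => by have := (hcle _ hi _ (by omega)).1 h; omega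
    · obtain ⟨j, hj, rfl⟩ := hcs z hz
      rw [hcle _ hj _ (by omega), hcle _ hi _ hj]
      omega
  have : Nonempty α := ⟨v⟩
  choose! w hws using hsep
  -- More than `2 * n` neighbours give `2 * n` consecutive pairs, so `n` separators lie on one side
  -- of `v`.
  let s := (Finset.range (2 * n)).filter fun i => w i ≤ v ∧ w i ≤ c (i + 1) ∧ ¬ w i ≤ c i
  let t := (Finset.range (2 * n)).filter fun i => ¬ (w i ≤ v ∧ w i ≤ c (i + 1) ∧ ¬ w i ≤ c i)
  have hst : s.card + t.card = 2 * n := by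
    rw [Finset.card_filter_add_card_filter_not, Finset.card_range]
  rcases (by omega : n ≤ s.card ∨ n ≤ t.card) with hn | hn
  · let g := s.orderEmbOfCardLe hn
    have hg : ∀ k, g k < 2 * n ∧ w (g k) ≤ v ∧ w (g k) ≤ c (g k + 1) ∧ ¬ w (g k) ≤ c (g k) :=
      fun k => by simpa [s] using s.orderEmbOfCardLe_mem hn k
    have hwc : ∀ j k, w (g j) ≤ c (g k) ↔ j < k := by
      intro j k
      rw [← g.lt_iff_lt]
      constructor
      · intro h
        by_contra hjk
        exact (hg j).2.2.2 (h.trans ((hcle _ (by grind) _ (by grind)).2 (by omega)))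
      · intro h
        exact (hg j).2.2.1.trans ((hcle _ (by grind) _ (by grind)).2 (by omega))
    have hcw : ∀ j k, ¬ c (g j) ≤ w (g k) := fun j k h =>
      (hc (g j) (by grind)).1 (h.trans (hg k).2.1)
    refine restr_P₁_embeds_of (a := fun k => c (g k)) (b := fun k => w (g k)) ?_ ?_
      (fun i j => hwc j i) hcw
    · refine fun i j hij => lt_of_le_not_ge ?_ ?_
      · exact (hcle _ (by grind) _ (by grind)).2 (g.lt_iff_lt.2 hij).le
      · rw [hcle _ (by grind) _ (by grind), not_le]
        exact g.lt_iff_lt.2 hij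
    · intro i j hij
      have hn : ¬ w (g j) ≤ w (g i) := fun h =>
        absurd ((hwc j j).1 (h.trans ((hwc i j).2 hij))) (lt_irrefl _)
      refine lt_of_le_not_ge ?_ hn
      by_contra h
      -- Incomparable separators would form a three-element antichain with this member of the chain.
      exact h3 (w (g i)) (w (g j)) (c (g i)) ⟨h, hn⟩
        ⟨fun h => by have := (hwc _ _).1 h; omega, hcw _ _⟩
        ⟨fun h => by have := (hwc _ _).1 h; omega, hcw _ _⟩
  · let g := t.orderEmbOfCardLe hn
    have hg : ∀ k, g k < 2 * n ∧ v ≤ w (g k) ∧ c (g k) ≤ w (g k) ∧ ¬ c (g k + 1) ≤ w (g k) :=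
      fun k => by
        have h := Finset.mem_filter.1 (t.orderEmbOfCardLe_mem hn k)
        have h1 : g k < 2 * n := Finset.mem_range.1 h.1
        exact ⟨h1, (hws (g k) (by omega)).resolve_left h.2⟩
    -- The shift to `g j + 1` makes the inequality strict: `w (g k)` is above `c (g k)` but not
    -- above its successor.
    have hcw : ∀ j k, c (g j + 1) ≤ w (g k) ↔ j < k := by
      intro j k
      rw [← g.lt_iff_lt]
      constructor
      · intro h
        by_contra hjk
        exact (hg k).2.2.2 (((hcle _ (by grind) _ (by grind)).2 (by omega)).trans h)
      · intro h
        exact ((hcle _ (by grind) _ (by grind)).2 (by omega)).trans (hg k).2.2.1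
    have hwc : ∀ j k, ¬ w (g j) ≤ c (g k + 1) := fun j k h =>
      (hc (g k + 1) (by grind)).2 ((hg j).2.1.trans h)
    refine restr_P₁_embeds_of (a := fun k => w (g k)) (b := fun k => c (g k + 1)) ?_ ?_
      (fun i j => hcw j i) hwc
    · intro i j hij
      have hn : ¬ w (g j) ≤ w (g i) := fun h =>
        absurd ((hcw i i).1 (((hcw i j).2 hij).trans h)) (lt_irrefl _)
      refine lt_of_le_not_ge ?_ hn
      by_contra h
      exact h3 (w (g i)) (w (g j)) (c (g j + 1)) ⟨h, hn⟩
        ⟨hwc _ _, fun h => by have := (hcw _ _).1 h; omega⟩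
        ⟨hwc _ _, fun h => by have := (hcw _ _).1 h; omega⟩
    · refine fun i j hij => lt_of_le_not_ge ?_ ?_
      · exact (hcle _ (by grind) _ (by grind)).2 (Nat.succ_le_succ (g.lt_iff_lt.2 hij).le)
      · rw [hcle _ (by grind) _ (by grind), not_le]
        exact Nat.succ_lt_succ (g.lt_iff_lt.2 hij)

/-- A large finite prime poset of width at most two embeds a large piece of `P₁` or of `P₂`. -/
theorem restr_embeds_of_isPrime [Finite α] (hw : WidthLeTwo (fun a b : α => a ≤ b))
    (hp : IsPrime (fun a b : α => a ≤ b)) {n : ℕ}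
    (hN : (2 * n + 1) ^ (n + 2) + 2 < Nat.card α) :
    Nonempty ((restr.{u} P₁ n).rel ↪r ((· ≤ ·) : α → α → Prop)) ∨
      Nonempty ((restr.{u} P₂ (n + 2)).rel ↪r ((· ≤ ·) : α → α → Prop)) := by
  have hG := connected_incGraph (by omega) hp
  -- Degree above `2 * n` serves `P₁`; path length `n + 2` ensures the two steps that orient the
  -- path.
  rcases SimpleGraph.exists_lt_ncard_neighborSet_or_lt_dist hG
    (d := 2 * n) (m := n + 2) (by omega) with ⟨v, hv⟩ | ⟨v, u, h⟩
  · exact Or.inl (restr_P₁_embeds hw hp hv)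
  · obtain ⟨p, hp⟩ := SimpleGraph.exists_induced_path hG h.le
    exact Or.inr (restr_P₂_embeds (fun i hi j hj => (hp i hi j hj).2)
      (fun i hi j hj => (hp i hi j hj).1) (by omega))

end Poset
end MinimalPrime
-- From posets to incomparability graphs.
namespace MinimalPrime

/-- This allows primality to be verified on the graphs and then inherited by the orders. -/
theorem IsModule.incompRel {α : Type*} {r : α → α → Prop} {A : Set α} (h : IsModule r A) :
    IsModule (IncompRel r) A := fun a ha b hb v hv =>
  ⟨fun h1 => ⟨fun h2 => h1.1 ((h b hb a ha v hv).1 h2), fun h2 => h1.2 ((h b hb a ha v hv).2 h2)⟩,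
    fun h1 => ⟨fun h2 => h1.1 ((h b hb a ha v hv).2 h2), fun h2 => h1.2 ((h b hb a ha v hv).1 h2)⟩⟩

theorem IsPrime.of_incompRel {α : Type*} {r : α → α → Prop} (h : IsPrime (IncompRel r)) :
    IsPrime r := fun A hA => h A hA.incompRel

/-- Embeddings of relations are embeddings of their incomparability relations. -/
def incompRelEmbedding {α β : Type*} {r : α → α → Prop} {s : β → β → Prop} (f : r ↪r s) :
    IncompRel r ↪r IncompRel s :=
  ⟨f.toEmbedding, and_congr (not_congr f.map_rel_iff) (not_congr f.map_rel_iff)⟩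

section P₁P₂

theorem incompRel_P₁_iff {x y : ℕ} :
    IncompRel P₁ x y ↔ (x < y ∧ x % 2 = 0 ∧ y % 2 = 1) ∨ (y < x ∧ y % 2 = 0 ∧ x % 2 = 1) := by
  unfold IncompRel P₁; omega

theorem incompRel_P₂_iff {x y : ℕ} : IncompRel P₂ x y ↔ x + 1 = y ∨ y + 1 = x := by
  unfold IncompRel P₂; omega

theorem widthLeTwo_P₁ : WidthLeTwo P₁ := widthLeTwo_iff.2 fun a b c => by
  simp only [incompRel_P₁_iff]; omega

theorem widthLeTwo_P₂ : WidthLeTwo P₂ := widthLeTwo_iff.2 fun a b c => by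
  simp only [incompRel_P₂_iff]; omega

/-- The incomparability graph of `P₂` is the one way infinite path. -/
def incompRelIsoInfinitePath : IncompRel P₂ ≃r infinitePath.Adj :=
  ⟨Equiv.refl ℕ, incompRel_P₂_iff.symm⟩

/-- The incomparability graph of `P₁` is the half-complete bipartite graph. -/
def incompRelIsoHalfGraph : IncompRel P₁ ≃r halfGraph.Adj where
  toFun x := if x % 2 = 0 then Sum.inl (x / 2) else Sum.inr (x / 2)
  invFun := Sum.elim (fun i => 2 * i) (fun j => 2 * j + 1)
  left_inv x := by
    by_cases h : x % 2 = 0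
    · simp only [h, if_true, Sum.elim_inl]; omega
    · simp only [h, if_false, Sum.elim_inr]; omega
  right_inv x := by
    rcases x with i | j
    · simp
    · have h : (2 * j + 1) % 2 = 1 := by omega
      have h' : (2 * j + 1) / 2 = j := by omega
      simp [h, h']
  map_rel_iff' {x y} := by
    rw [incompRel_P₁_iff]
    by_cases hx : x % 2 = 0 <;> by_cases hy : y % 2 = 0 <;> simp [halfGraph, hx, hy] <;> omega

end P₁P₂

/-! ### Prime initial segments, and ages. -/

section Restr

/-- Only one half of the module condition is kept; for the symmetric relations used below the other
half is equivalent. -/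
theorem isPrime_restr {s : ℕ → ℕ → Prop} {n : ℕ}
    (h : ∀ B : Set ℕ, (∀ a ∈ B, ∀ b ∈ B, ∀ v < n, s v a → ¬ s v b → v ∈ B) →
      ∀ x ∈ B, ∀ y ∈ B, x < y → y < n → ∀ z < n, z ∈ B) : IsPrime (restr.{u} s n).rel := by
  intro A hA
  by_contra! hc
  obtain ⟨x, hx⟩ := hc.1
  obtain ⟨y, hy, hxy⟩ : ∃ y ∈ A, y ≠ x := by
    by_contra! hy
    exact hc.2.1 x (Set.eq_singleton_iff_unique_mem.2 ⟨hx, hy⟩)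
  have key := h {i | ∃ hi : i < n, (ULift.up ⟨i, hi⟩ : ULift.{u} (Fin n)) ∈ A} (by
    rintro a ⟨ha, haA⟩ b ⟨hb, hbA⟩ v hv hva hvb
    refine ⟨hv, ?_⟩
    by_contra hvA
    exact hvb ((hA _ haA _ hbA _ hvA).1 hva))
  refine hc.2.2 (Set.eq_univ_of_forall fun z => ?_)
  have hne : (x.down : ℕ) ≠ y.down := fun h => hxy (ULift.ext _ _ (Fin.ext h.symm))
  rcases hne.lt_or_gt with hlt | hlt
  · exact (key _ ⟨x.down.2, hx⟩ _ ⟨y.down.2, hy⟩ hlt y.down.2 z.down z.down.2).2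
  · exact (key _ ⟨y.down.2, hy⟩ _ ⟨x.down.2, hx⟩ hlt x.down.2 z.down z.down.2).2

theorem isPrime_restr_incompRel_P₂ (n : ℕ) :
    IsPrime (restr.{u} (IncompRel P₂) (n + 4)).rel := by
  refine isPrime_restr fun B hB x hx y hy hxy hyn => ?_
  simp only [incompRel_P₂_iff] at hB
  -- A vertex adjacent to exactly one of two members joins `B`. At distance two this needs a vertex
  -- beyond an end, hence at least four vertices. A consecutive pair then spreads both ways.
  obtain ⟨k, hk, hk1, hkn⟩ : ∃ k, k ∈ B ∧ k + 1 ∈ B ∧ k + 1 < n + 4 := by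
    rcases (by omega : y = x + 1 ∨ x + 3 ≤ y ∨ (y = x + 2 ∧ (y + 1 < n + 4 ∨ 1 ≤ x)))
      with rfl | h | ⟨rfl, h | h⟩
    · exact ⟨x, hx, hy, hyn⟩
    · exact ⟨x, hx, hB x hx y hy (x + 1) (by omega) (by omega) (by omega), by omega⟩
    · exact ⟨x + 2, hy, hB _ hy _ hx _ h (by omega) (by omega), h⟩
    · obtain ⟨w, rfl⟩ := Nat.exists_eq_add_of_le' h
      exact ⟨w, hB _ hx _ hy w (by omega) (by omega) (by omega), hx, by omega⟩
  have up : ∀ j, k + 1 + j < n + 4 → k + j ∈ B ∧ k + 1 + j ∈ B := by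
    intro j
    induction j with
    | zero => exact fun _ => ⟨hk, hk1⟩
    | succ j ih =>
      intro hj
      obtain ⟨h1, h2⟩ := ih (by omega)
      refine ⟨by convert h2 using 1; omega, hB _ h2 _ h1 _ hj (by omega) (by omega)⟩
  have down : ∀ j ≤ k, k - j ∈ B ∧ k - j + 1 ∈ B := by
    intro j
    induction j with
    | zero => exact fun _ => ⟨hk, hk1⟩
    | succ j ih =>
      intro hj
      obtain ⟨h1, h2⟩ := ih (by omega)
      exact ⟨hB _ h1 _ h2 _ (by omega) (by omega) (by omega), by convert h1 using 1; omega⟩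
  intro z hz
  rcases le_total z k with h | h
  · convert (down (k - z) (by omega)).1 using 1; omega
  · rcases h.eq_or_lt with rfl | h
    · exact hk
    · convert (up (z - k - 1) (by omega)).2 using 1; omega

/-- The vertex `0` is adjacent to all odd vertices and `2 * n + 1` to all even ones, so a module
with members of both parities absorbs everything. With an odd number of vertices the last one would
be isolated. -/
theorem isPrime_restr_incompRel_P₁ (n : ℕ) :
    IsPrime (restr.{u} (IncompRel P₁) (2 * n + 2)).rel := by
  refine isPrime_restr fun B hB x hx y hy hxy hyn => ?_
  simp only [incompRel_P₁_iff] at hB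
  obtain ⟨a, b, ha, hb, ha2, hb2, han, hbn⟩ : ∃ a b, a ∈ B ∧ b ∈ B ∧ a % 2 = 0 ∧ b % 2 = 1 ∧
      a < 2 * n + 2 ∧ b < 2 * n + 2 := by
    rcases Nat.mod_two_eq_zero_or_one x with h | h <;>
      rcases Nat.mod_two_eq_zero_or_one y with h' | h'
    · exact ⟨x, x + 1, hx, hB x hx y hy _ (by omega) (by omega) (by omega), by omega, by omega,
        by omega, by omega⟩
    · exact ⟨x, y, hx, hy, h, h', by omega, hyn⟩
    · exact ⟨y, x, hy, hx, h', h, hyn, by omega⟩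
    · exact ⟨y - 1, y, hB y hy x hx _ (by omega) (by omega) (by omega), hy, by omega, by omega,
        by omega, by omega⟩
  have h0 : 0 ∈ B := hB b hb a ha 0 (by omega) (by omega) (by omega)
  have hodd : ∀ z < 2 * n + 2, z % 2 = 1 → z ∈ B := fun z hz hz2 => by
    exact hB 0 h0 b hb z hz (by omega) (by omega)
  have hlast := hodd (2 * n + 1) (by omega) (by omega)
  intro z hz
  rcases Nat.mod_two_eq_zero_or_one z with h | h
  · exact hB _ hlast 0 h0 z hz (by omega) (by omega)
  · exact hodd z hz h

theorem restr_mem_age (s : ℕ → ℕ → Prop) (n : ℕ) : restr.{u} s n ∈ age.{u} s :=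
  ⟨⟨⟨fun x => x.down, fun _ _ h => ULift.ext _ _ (Fin.ext h)⟩, Iff.rfl⟩⟩

theorem embeds_restr {R : FinStr.{u}} {s : ℕ → ℕ → Prop} (hR : R ∈ age.{u} s) :
    ∃ n, ∀ m ≥ n, R.Embeds (restr.{u} s m) := by
  obtain ⟨f⟩ := hR
  have := R.finite
  obtain ⟨n, hn⟩ := (Set.finite_range f).bddAbove
  refine ⟨n + 1, fun m hm => ⟨⟨⟨fun x => ⟨f x, ?_⟩, fun x y h => f.injective ?_⟩, f.map_rel_iff⟩⟩⟩
  · have := hn ⟨x, rfl⟩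
    omega
  · exact congrArg (fun x => (x.down : ℕ)) h

theorem isHereditary_age {α : Type*} (r : α → α → Prop) : IsHereditary (age.{u} r) :=
  fun _ _ ⟨f⟩ ⟨g⟩ => ⟨g.trans f⟩

theorem age_congr {α β : Type*} {r : α → α → Prop} {s : β → β → Prop} (e : r ≃r s) :
    age.{u} r = age.{u} s :=
  Set.ext fun _ => ⟨fun ⟨f⟩ => ⟨f.trans e.toRelEmbedding⟩,
    fun ⟨f⟩ => ⟨f.trans e.symm.toRelEmbedding⟩⟩

/-- A hereditary class containing arbitrarily long restrictions of `s` or of `t` contains one of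
their ages. -/
theorem age_subset_or_age_subset {D : Set FinStr.{u}} (hD : IsHereditary D)
    {s t : ℕ → ℕ → Prop} (h : ∀ n, ∃ m ≥ n, restr.{u} s m ∈ D ∨ restr.{u} t m ∈ D) :
    age.{u} s ⊆ D ∨ age.{u} t ⊆ D := by
  -- A member of an age missing from `D` excludes all sufficiently long restrictions.
  by_contra! hc
  simp only [Set.not_subset] at hc
  obtain ⟨⟨R, hR, hRD⟩, S, hS, hSD⟩ := hc
  obtain ⟨n, hn⟩ := embeds_restr hR
  obtain ⟨k, hk⟩ := embeds_restr hS
  obtain ⟨m, hm, h | h⟩ := h (max n k)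
  · exact hRD (hD _ _ h (hn m (by omega)))
  · exact hSD (hD _ _ h (hk m (by omega)))

end Restr

/-! ### Counting prime types, and the criterion for minimality. -/

section PrimeTypes

theorem finite_isoTypes (N : ℕ) :
    (Quotient.mk isoSetoid.{u} '' {R | Nat.card R.carrier ≤ N}).Finite := by
  let F : (Σ n : Fin (N + 1), Fin n → Fin n → Prop) → Quotient isoSetoid.{u} := fun p =>
    Quotient.mk _ ⟨ULift.{u} (Fin p.1), inferInstance, fun x y => p.2 x.down y.down⟩
  refine (Set.finite_range F).subset ?_
  rintro _ ⟨R, hR, rfl⟩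
  have := R.finite
  let e : R.carrier ≃ Fin (Nat.card R.carrier) := Finite.equivFin _
  refine ⟨⟨⟨Nat.card R.carrier, Nat.lt_succ_of_le hR⟩, fun x y => R.rel (e.symm x) (e.symm y)⟩,
    Quotient.sound ⟨⟨Equiv.ulift.trans e.symm, Iff.rfl⟩⟩⟩

theorem exists_large_prime {D : Set FinStr.{u}} (hD : (primeTypes D).Infinite) (N : ℕ) :
    ∃ R ∈ D, IsPrime R.rel ∧ N < Nat.card R.carrier := by
  by_contra! hc
  exact hD ((finite_isoTypes N).subset (Set.image_mono fun R hR => hc R hR.1 hR.2))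

theorem infinite_primeTypes_age {s : ℕ → ℕ → Prop} {g : ℕ → ℕ} (hg : g.Injective)
    (h : ∀ n, IsPrime (restr.{u} s (g n)).rel) : (primeTypes (age.{u} s)).Infinite := by
  refine Set.infinite_of_injective_forall_mem
    (f := fun n => Quotient.mk isoSetoid.{u} (restr.{u} s (g n))) (fun m n hmn => ?_)
    fun n => ⟨_, ⟨restr_mem_age s _, h n⟩, rfl⟩
  obtain ⟨e⟩ := Quotient.exact hmn
  have h1 := Nat.card_congr e.toEquiv
  simp only [restr, Nat.card_eq_fintype_card, Fintype.card_ulift, Fintype.card_fin] at h1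
  exact hg h1

/-- If every hereditary subclass of `K` with infinitely many primes contains one of two
incomparable ages with infinitely many primes, then these ages are the minimal prime subclasses. -/
theorem isMinimalPrime_iff {K : Set FinStr.{u}} {s t : ℕ → ℕ → Prop}
    (his : (primeTypes (age.{u} s)).Infinite) (hit : (primeTypes (age.{u} t)).Infinite)
    (hst : ¬ age.{u} s ⊆ age.{u} t) (hts : ¬ age.{u} t ⊆ age.{u} s)
    (hK : ∀ D ⊆ K, IsHereditary D → (primeTypes D).Infinite →
      age.{u} s ⊆ D ∨ age.{u} t ⊆ D) {C : Set FinStr.{u}} (hC : C ⊆ K) :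
    IsMinimalPrime C ↔ C = age.{u} s ∨ C = age.{u} t := by
  constructor
  · intro h
    rcases hK C hC h.hereditary h.infinite with h1 | h1
    · refine Or.inl (by_contra fun hne => his ?_)
      exact h.minimal _ (h1.ssubset_of_ne (Ne.symm hne)) (isHereditary_age s)
    · refine Or.inr (by_contra fun hne => hit ?_)
      exact h.minimal _ (h1.ssubset_of_ne (Ne.symm hne)) (isHereditary_age t)
  · rintro (rfl | rfl)
    · refine ⟨isHereditary_age s, his, fun D hD hDh => ?_⟩
      by_contra hDi
      -- Containing its own age contradicts properness; containing the other one contradicts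
      -- incomparability of the ages.
      rcases hK D (hD.subset.trans hC) hDh hDi with h | h
      · exact hD.not_subset h
      · exact hts (h.trans hD.subset)
    · refine ⟨isHereditary_age t, hit, fun D hD hDh => ?_⟩
      by_contra hDi
      rcases hK D (hD.subset.trans hC) hDh hDi with h | h
      · exact hst (h.trans hD.subset)
      · exact hD.not_subset h

end PrimeTypes

/-! ### The ages of `P₁`, `P₂` and their graphs. -/

section Ages

theorem infinite_primeTypes_age_incompRel_P₁ :
    (primeTypes (age.{u} (IncompRel P₁))).Infinite :=
  infinite_primeTypes_age (g := fun n => 2 * n + 2) (fun m n h => by grind)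
    isPrime_restr_incompRel_P₁

theorem infinite_primeTypes_age_incompRel_P₂ :
    (primeTypes (age.{u} (IncompRel P₂))).Infinite :=
  infinite_primeTypes_age (g := fun n => n + 4) (fun m n h => by grind)
    isPrime_restr_incompRel_P₂

theorem infinite_primeTypes_age_P₁ : (primeTypes (age.{u} P₁)).Infinite :=
  infinite_primeTypes_age (g := fun n => 2 * n + 2) (fun m n h => by grind)
    fun n => (isPrime_restr_incompRel_P₁ n).of_incompRel

theorem infinite_primeTypes_age_P₂ : (primeTypes (age.{u} P₂)).Infinite :=
  infinite_primeTypes_age (g := fun n => n + 4) (fun m n h => by grind)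
    fun n => (isPrime_restr_incompRel_P₂ n).of_incompRel

/-- The half graph has a vertex of degree three, and the path has none. -/
theorem restr_incompRel_P₁_notMem_age :
    restr.{u} (IncompRel P₁) 6 ∉ age.{u} (IncompRel P₂) := by
  rintro ⟨f⟩
  let v : Fin 6 → ULift.{u} (Fin 6) := ULift.up
  have h : ∀ i : Fin 6, i.1 % 2 = 1 → IncompRel P₂ (f (v 0)) (f (v i)) := fun i hi =>
    f.map_rel_iff.2 (incompRel_P₁_iff.2 (Or.inl ⟨by dsimp [v]; omega, rfl, hi⟩))
  have hne : ∀ i j : Fin 6, i ≠ j → f (v i) ≠ f (v j) := fun i j hij h =>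
    hij (congrArg ULift.down (f.injective h))
  have h1 := incompRel_P₂_iff.1 (h 1 (by decide))
  have h3 := incompRel_P₂_iff.1 (h 3 (by decide))
  have h5 := incompRel_P₂_iff.1 (h 5 (by decide))
  have h13 := hne 1 3 (by decide)
  have h15 := hne 1 5 (by decide)
  have h35 := hne 3 5 (by decide)
  omega

/-- The path has two independent edges, and the half graph does not. -/
theorem restr_incompRel_P₂_notMem_age :
    restr.{u} (IncompRel P₂) 5 ∉ age.{u} (IncompRel P₁) := by
  rintro ⟨f⟩
  let v : Fin 5 → ULift.{u} (Fin 5) := ULift.up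
  have h : ∀ i j : Fin 5, (IncompRel P₁ (f (v i)) (f (v j)) ↔ i.1 + 1 = j.1 ∨ j.1 + 1 = i.1) :=
    fun i j => f.map_rel_iff.trans incompRel_P₂_iff
  have h01 := incompRel_P₁_iff.1 ((h 0 1).2 (by decide))
  have h34 := incompRel_P₁_iff.1 ((h 3 4).2 (by decide))
  have hn : ∀ i j : Fin 5, ¬ (i.1 + 1 = j.1 ∨ j.1 + 1 = i.1) → ¬ _ := fun i j hij =>
    mt incompRel_P₁_iff.2 (mt (h i j).1 hij)
  -- Of two edges, the smaller even end lies below both odd ends and so is adjacent to both; the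
  -- cases say which ends are even.
  rcases h01 with h01 | h01 <;> rcases h34 with h34 | h34
  · have h1 := hn 0 4 (by decide)
    have h2 := hn 1 3 (by decide)
    omega
  · have h1 := hn 0 3 (by decide)
    have h2 := hn 1 4 (by decide)
    omega
  · have h1 := hn 1 4 (by decide)
    have h2 := hn 0 3 (by decide)
    omega
  · have h1 := hn 1 3 (by decide)
    have h2 := hn 0 4 (by decide)
    omega

theorem restr_embeds_of_isPrime_rel {α : Type*} [Finite α] {r : α → α → Prop}
    (hr : IsPartialOrder α r) (hw : WidthLeTwo r) (hp : IsPrime r) {n : ℕ}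
    (hN : (2 * n + 1) ^ (n + 2) + 2 < Nat.card α) :
    Nonempty ((restr.{u} P₁ n).rel ↪r r) ∨ Nonempty ((restr.{u} P₂ (n + 2)).rel ↪r r) := by
  let : PartialOrder α :=
    { le := r
      le_refl := hr.refl
      le_trans := hr.trans
      le_antisymm := hr.antisymm }
  exact restr_embeds_of_isPrime hw hp hN

theorem age_P₁_subset_or_age_P₂_subset {D : Set FinStr.{u}} (hDK : D ⊆ {R | R.IsPosetWidthLeTwo})
    (hD : IsHereditary D) (hDi : (primeTypes D).Infinite) :
    age.{u} P₁ ⊆ D ∨ age.{u} P₂ ⊆ D := by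
  refine age_subset_or_age_subset hD fun n => ?_
  obtain ⟨R, hR, hp, hN⟩ := exists_large_prime hDi ((2 * n + 1) ^ (n + 2) + 2)
  have := R.finite
  rcases restr_embeds_of_isPrime_rel (hDK hR).1 (hDK hR).2 hp hN with h | h
  · exact ⟨n, le_rfl, Or.inl (hD _ _ hR h)⟩
  · exact ⟨n + 2, by omega, Or.inr (hD _ _ hR h)⟩

theorem age_incompRel_P₁_subset_or_age_incompRel_P₂_subset {D : Set FinStr.{u}}
    (hDK : D ⊆ {R | R.IsIncGraphWidthLeTwo})
    (hD : IsHereditary D) (hDi : (primeTypes D).Infinite) :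
    age.{u} (IncompRel P₁) ⊆ D ∨ age.{u} (IncompRel P₂) ⊆ D := by
  refine age_subset_or_age_subset hD fun n => ?_
  obtain ⟨R, hR, hp, hN⟩ := exists_large_prime hDi ((2 * n + 1) ^ (n + 2) + 2)
  have := R.finite
  obtain ⟨le, hle, hw, hrel⟩ := hDK hR
  have hrel' : R.rel = IncompRel le := funext fun x => funext fun y => propext (hrel x y)
  rcases restr_embeds_of_isPrime_rel hle hw (hrel' ▸ hp).of_incompRel hN with f | f
  · refine ⟨n, le_rfl, Or.inl (hD _ _ hR ?_)⟩
    rw [FinStr.Embeds, hrel']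
    exact f.map incompRelEmbedding
  · refine ⟨n + 2, by omega, Or.inr (hD _ _ hR ?_)⟩
    rw [FinStr.Embeds, hrel']
    exact f.map incompRelEmbedding

/-- Through this, the witnesses separating the two graph ages also separate the poset ages. -/
theorem age_incompRel_mono {s t : ℕ → ℕ → Prop} (h : age.{u} s ⊆ age.{u} t) :
    ∀ n, restr.{u} (IncompRel s) n ∈ age.{u} (IncompRel t) := fun n =>
  (h (restr_mem_age s n)).map incompRelEmbedding

end Ages

end MinimalPrime

theorem mainTheorem6 :
    -- hereditary classes of finite posets of width at most two
    (∀ C : Set MinimalPrime.FinStr.{u}, MinimalPrime.IsHereditary C →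
      (∀ R ∈ C, R.IsPosetWidthLeTwo) →
      (MinimalPrime.IsMinimalPrime C ↔
        C = MinimalPrime.age MinimalPrime.P₁ ∨ C = MinimalPrime.age MinimalPrime.P₂)) ∧
    -- hereditary classes of finite incomparability graphs of posets of width at most two
    (∀ C : Set MinimalPrime.FinStr.{u}, MinimalPrime.IsHereditary C →
      (∀ R ∈ C, R.IsIncGraphWidthLeTwo) →
      (MinimalPrime.IsMinimalPrime C ↔
        C = MinimalPrime.age MinimalPrime.halfGraph.Adj ∨
        C = MinimalPrime.age MinimalPrime.infinitePath.Adj)) ∧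
    -- `P₁` and `P₂` have width at most two, with incomparability graphs `H` and the infinite path
    MinimalPrime.WidthLeTwo MinimalPrime.P₁ ∧
    MinimalPrime.WidthLeTwo MinimalPrime.P₂ ∧
    Nonempty (IncompRel MinimalPrime.P₁ ≃r MinimalPrime.halfGraph.Adj) ∧
    Nonempty (IncompRel MinimalPrime.P₂ ≃r MinimalPrime.infinitePath.Adj) := by
  refine ⟨fun C _ hCK => ?_, fun C _ hCK => ?_, MinimalPrime.widthLeTwo_P₁,
    MinimalPrime.widthLeTwo_P₂, ⟨MinimalPrime.incompRelIsoHalfGraph⟩,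
    ⟨MinimalPrime.incompRelIsoInfinitePath⟩⟩
  · exact MinimalPrime.isMinimalPrime_iff MinimalPrime.infinite_primeTypes_age_P₁
      MinimalPrime.infinite_primeTypes_age_P₂
      (fun h => MinimalPrime.restr_incompRel_P₁_notMem_age (MinimalPrime.age_incompRel_mono h 6))
      (fun h => MinimalPrime.restr_incompRel_P₂_notMem_age (MinimalPrime.age_incompRel_mono h 5))
      (fun _ => MinimalPrime.age_P₁_subset_or_age_P₂_subset) hCK
  · rw [← MinimalPrime.age_congr MinimalPrime.incompRelIsoHalfGraph,
      ← MinimalPrime.age_congr MinimalPrime.incompRelIsoInfinitePath]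
    exact MinimalPrime.isMinimalPrime_iff MinimalPrime.infinite_primeTypes_age_incompRel_P₁
      MinimalPrime.infinite_primeTypes_age_incompRel_P₂
      (fun h => MinimalPrime.restr_incompRel_P₁_notMem_age (h (MinimalPrime.restr_mem_age _ 6)))
      (fun h => MinimalPrime.restr_incompRel_P₂_notMem_age (h (MinimalPrime.restr_mem_age _ 5)))
      (fun _ => MinimalPrime.age_incompRel_P₁_subset_or_age_incompRel_P₂_subset) hCK
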